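/- Let $s>0$ and let $\mathcal P=\mathbb R[S_1,S_2,S_3]/(S_1^2+S_2^2+S_3^2-s^2)$ be the algebra of polynomials in the components of the spin vector on the sphere $S^2$ of radius $s$, equipped with the Poisson bracket $$\{f,g\}=\sum_{i,j,k=1}^3\epsilon_{ijk}\,S_i\,\frac{\partial f}{\partial S_j}\,\frac{\partial g}{\partial S_k},$$ and let $\mathcal P^1\subset\mathcal P$ be the subspace of polynomials of degree at most $1$, i.e. the span of $1,S_1,S_2,S_3$. An admissible quantization of $(\mathcal P,\mathcal P^1)$ is a real-linear map $\mathcal Q$ from $\mathcal P$ to the (bounded) self-adjoint operators on a complex Hilbert space $H$ such that $\mathcal Q(\{f,g\})=-\mathrm i\,[\mathcal Q(f),\mathcal Q(g)]$ for all $f,g\in\mathcal P$, $\mathcal Q(1)=I$, and $\mathcal Q$ is irreducible on $\mathcal P^1$: $H\neq 0$, and the only closed subspaces of $H$ invariant under all $\mathcal Q(f)$, $f\in\mathcal P^1$, are $0$ and $H$. If $\mathcal Q$ is an admissible quantization of $(\mathcal P,\mathcal P^1)$, then there are real constants $a,c$ with $a^2+c^2\neq 0$ such that $$\mathcal Q(S_i^2)=a\,\mathcal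 Q(S_i)^2+cI\qquad(i=1,2,3),$$ and, for the same $a$ and all $i\neq\ell$ in $\{1,2,3\}$, $$\mathcal Q(S_iS_\ell)=\frac a2\bigl(\mathcal Q(S_i)\mathcal Q(S_\ell)+\mathcal Q(S_\ell)\mathcal Q(S_i)\bigr).$$ -/

import Mathlib

noncomputable section

namespace SpinSphere

open MvPolynomial

/-- The Levi-Civita symbol `ε i j k`; index arithmetic is modulo 3. -/
def eps (i j k : Fin 3) : ℝ :=
  if j = i + 1 ∧ k = i + 2 then 1 else if j = i + 2 ∧ k = i + 1 then -1 else 0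

/-- The expression `∑ ε i j k S_i (∂f/∂S_j) (∂g/∂S_k)` for polynomials in three variables. -/
def preBracket (f g : MvPolynomial (Fin 3) ℝ) : MvPolynomial (Fin 3) ℝ :=
  ∑ i, ∑ j, ∑ k, C (eps i j k) * X i * pderiv j f * pderiv k g

/-- The polynomial `S_1² + S_2² + S_3² - s²` that cuts out the sphere of radius `s`. -/
def sphereRel (s : ℝ) : MvPolynomial (Fin 3) ℝ :=
  ∑ i, X i ^ 2 - C (s ^ 2)

/-- The ideal generated by the sphere relation. -/
abbrev sphereIdeal (s : ℝ) : Ideal (MvPolynomial (Fin 3) ℝ) :=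
  Ideal.span {sphereRel s}

/-- The algebra `𝒫` of real polynomials in `S_1, S_2, S_3` modulo `S_1² + S_2² + S_3² = s²`. -/
abbrev Poly (s : ℝ) : Type :=
  MvPolynomial (Fin 3) ℝ ⧸ sphereIdeal s

theorem preBracket_sub_left (f f' g : MvPolynomial (Fin 3) ℝ) :
    preBracket (f - f') g = preBracket f g - preBracket f' g := by
  simp only [preBracket, map_sub, mul_sub, sub_mul, Finset.sum_sub_distrib]

theorem preBracket_sub_right (f g g' : MvPolynomial (Fin 3) ℝ) :
    preBracket f (g - g') = preBracket f g - preBracket f g' := by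
  simp only [preBracket, map_sub, mul_sub, Finset.sum_sub_distrib]

theorem preBracket_eq (f g : MvPolynomial (Fin 3) ℝ) :
    preBracket f g =
      X 0 * (pderiv 1 f * pderiv 2 g - pderiv 2 f * pderiv 1 g)
      + X 1 * (pderiv 2 f * pderiv 0 g - pderiv 0 f * pderiv 2 g)
      + X 2 * (pderiv 0 f * pderiv 1 g - pderiv 1 f * pderiv 0 g) := by
  simp only [preBracket, Fin.sum_univ_three, eps]
  simp
  ring

theorem preBracket_skew (f g : MvPolynomial (Fin 3) ℝ) :
    preBracket f g = -preBracket g f := by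
  rw [preBracket_eq, preBracket_eq]; ring

theorem preBracket_sphereRel_mul (s : ℝ) (h g : MvPolynomial (Fin 3) ℝ) :
    preBracket (sphereRel s * h) g = sphereRel s * preBracket h g := by
  rw [preBracket_eq, preBracket_eq]
  have h0 : pderiv 0 (sphereRel s) = 2 * X 0 := by
    simp [sphereRel, Fin.sum_univ_three, Derivation.leibniz_pow, pderiv_X]
  have h1 : pderiv 1 (sphereRel s) = 2 * X 1 := by
    simp [sphereRel, Fin.sum_univ_three, Derivation.leibniz_pow, pderiv_X]
  have h2 : pderiv 2 (sphereRel s) = 2 * X 2 := by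
    simp [sphereRel, Fin.sum_univ_three, Derivation.leibniz_pow, pderiv_X]
  simp only [pderiv_mul, h0, h1, h2]
  ring

theorem preBracket_mem_left (s : ℝ) {f : MvPolynomial (Fin 3) ℝ} (hf : f ∈ sphereIdeal s)
    (g : MvPolynomial (Fin 3) ℝ) : preBracket f g ∈ sphereIdeal s := by
  obtain ⟨h, rfl⟩ := Ideal.mem_span_singleton.1 hf
  rw [preBracket_sphereRel_mul]
  exact Ideal.mem_span_singleton.2 (dvd_mul_right _ _)

theorem preBracket_mem_right (s : ℝ) (f : MvPolynomial (Fin 3) ℝ) {g : MvPolynomial (Fin 3) ℝ}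
    (hg : g ∈ sphereIdeal s) : preBracket f g ∈ sphereIdeal s := by
  rw [preBracket_skew]
  exact neg_mem (preBracket_mem_left s hg f)

theorem preBracket_congr (s : ℝ) (f f' g g' : MvPolynomial (Fin 3) ℝ)
    (hf : f - f' ∈ sphereIdeal s) (hg : g - g' ∈ sphereIdeal s) :
    preBracket f g - preBracket f' g' ∈ sphereIdeal s := by
  have h : preBracket f g - preBracket f' g' =
      preBracket (f - f') g + preBracket f' (g - g') := by
    rw [preBracket_sub_left, preBracket_sub_right]; ring
  rw [h]
  exact add_mem (preBracket_mem_left s hf g) (preBracket_mem_right s f' hg)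

/-- The Poisson bracket on `𝒫`: the class of `∑ ε i j k S_i (∂f/∂S_j) (∂g/∂S_k)`. -/
def poisson {s : ℝ} (p q : Poly s) : Poly s :=
  Quotient.liftOn₂' p q
    (fun f g => Ideal.Quotient.mk (sphereIdeal s) (preBracket f g))
    (fun f g f' g' hf hg => Ideal.Quotient.eq.2
      (preBracket_congr s f f' g g'
        ((Submodule.quotientRel_def _).1 hf) ((Submodule.quotientRel_def _).1 hg)))

theorem poisson_mk {s : ℝ} (f g : MvPolynomial (Fin 3) ℝ) :
    poisson (Ideal.Quotient.mk (sphereIdeal s) f) (Ideal.Quotient.mk (sphereIdeal s) g)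
      = Ideal.Quotient.mk (sphereIdeal s) (preBracket f g) := rfl

/-- The component `S_i` of the spin vector, as an element of `𝒫`. -/
def S {s : ℝ} (i : Fin 3) : Poly s :=
  Ideal.Quotient.mk (sphereIdeal s) (X i)

/-- The subspace `𝒫^k` of classes with a polynomial representative of degree at most `k`. -/
def degLE (s : ℝ) (k : ℕ) : Submodule ℝ (Poly s) :=
  (restrictTotalDegree (Fin 3) ℝ k).map (Ideal.Quotient.mkₐ ℝ (sphereIdeal s)).toLinearMap

section Quantization

variable {s : ℝ} {H : Type*} [NormedAddCommGroup H] [InnerProductSpace ℂ H] [CompleteSpace H]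

/-- A quantization of `𝒫`: a real-linear map to (bounded) self-adjoint operators on a complex
Hilbert space with `𝒬({f, g}) = -i [𝒬(f), 𝒬(g)]` and `𝒬(1) = I`. -/
structure IsQuantization (Q : Poly s →ₗ[ℝ] (H →L[ℂ] H)) : Prop where
  isSelfAdjoint : ∀ f, IsSelfAdjoint (Q f)
  map_poisson : ∀ f g, Q (poisson f g) = (-Complex.I) • (Q f * Q g - Q g * Q f)
  map_one : Q 1 = 1

/-- `𝒬` is irreducible on `B`: the Hilbert space is nonzero, and its only closed subspaces that
are invariant under all `𝒬(f)`, `f ∈ B`, are zero and the whole space. -/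
structure IsIrreducibleOn (Q : Poly s →ₗ[ℝ] (H →L[ℂ] H)) (B : Submodule ℝ (Poly s)) : Prop where
  nontrivial : Nontrivial H
  eq_bot_or_eq_top : ∀ K : Submodule ℂ H, IsClosed (K : Set H) →
    (∀ f ∈ B, ∀ x ∈ K, Q f x ∈ K) → K = ⊥ ∨ K = ⊤

/-- An admissible quantization of `(𝒫, B)`. -/
structure IsAdmissibleQuantization (Q : Poly s →ₗ[ℝ] (H →L[ℂ] H))
    (B : Submodule ℝ (Poly s)) : Prop extends IsQuantization Q, IsIrreducibleOn Q B

end Quantization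

end SpinSphere

end

/-!
The ladder operators `R`, `L` of a bounded spin are nilpotent: their powers are eigenvectors, with
unbounded eigenvalues, of commutation with the bounded operator `Z`. Hence there is a lowest weight
vector `w`, and by irreducibility the vectors `R ^ k w` span the space, with distinct weights. An
operator that commutes with `R` and raises weights by `n` is therefore a multiple of `R ^ n`.

The operators `Q (S_i S_l)` form a symmetric tensor `X` for the spin `Q (S_i)`. Its component along
the isotropic vector `x + i y` commutes with `R` and has weight two, so it is a multiple of `R ^ 2`,
which is also that component of the tensor of anticommutators. Subtracting the corresponding
multiple leaves a symmetric tensor whose highest component vanishes; lowering it shows that it is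
isotropic, and its scalar commutes with the spin, hence is a multiple of `R ^ 0 = 1`. Both
coefficients are real because all operators involved are self-adjoint, and they cannot both vanish
because the trace of `X` is `s ^ 2`.
-/

namespace SpinSphere

open Complex MvPolynomial
open scoped Matrix

attribute [local instance] LieRing.ofAssociativeRing

section Ladder

variable {A M : Type*} [Ring A] [AddCommGroup M] [Module A M] {Z R L : A}

theorem lie_mul (a b c : A) : ⁅a, b * c⁆ = ⁅a, b⁆ * c + b * ⁅a, c⁆ := by
  simp only [Ring.lie_def]
  noncomm_ring

theorem lie_pow_of_lie_eq_self (h : ⁅Z, R⁆ = R) (n : ℕ) : ⁅Z, R ^ n⁆ = n • R ^ n := by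
  induction n with
  | zero => simp [Ring.lie_def]
  | succ n ih => rw [pow_succ, lie_mul, ih, h, smul_mul_assoc, ← succ_nsmul]

/-- The commutation relations of the operators `S_z`, `S_+ = S_x + i S_y`, `S_- = S_x - i S_y` of a
spin. Up to the factor `h = 2 Z` this is Mathlib's `IsSl2Triple`, except that `Z` may vanish, as it
does in spin zero. -/
structure IsLadder (Z R L : A) : Prop where
  lie_raise : ⁅Z, R⁆ = R
  lie_lower : ⁅Z, L⁆ = -L
  lie_raise_lower : ⁅R, L⁆ = 2 • Z

namespace IsLadder

theorem lie_lower_pow_succ (h : IsLadder Z R L) (n : ℕ) :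
    ⁅L, R ^ (n + 1)⁆ = -((n + 1) • (R ^ n * (2 • Z + n • 1))) := by
  have lower_raise : ⁅L, R⁆ = -(2 • Z) := by rw [← lie_skew, h.lie_raise_lower]
  have weight_mul_raise : Z * R = R * Z + R := by
    rw [← sub_eq_iff_eq_add', ← Ring.lie_def, h.lie_raise]
  induction n with
  | zero => simp [lower_raise]
  | succ n ih =>
    have shift : (2 • Z + n • 1) * R = R * (2 • Z + (n + 2) • 1) := by
      rw [add_mul, smul_mul_assoc, weight_mul_raise, smul_mul_assoc, one_mul, mul_add,
        mul_smul_comm, mul_smul_comm, mul_one]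
      module
    rw [pow_succ R (n + 1), lie_mul, ih, lower_raise, neg_mul, smul_mul_assoc, mul_assoc, shift,
      ← mul_assoc, ← pow_succ]
    simp only [mul_add, mul_neg, mul_smul_comm, mul_one]
    module

theorem lower_smul_pow_succ_smul (h : IsLadder Z R L) {v : M} (hv : L • v = 0) (n : ℕ) :
    L • R ^ (n + 1) • v = -((n + 1) • R ^ n • (2 • Z • v + n • v)) := by
  have commutator := congr($(h.lie_lower_pow_succ n) • v)
  rwa [Ring.lie_def, sub_smul, mul_smul, mul_smul, hv, smul_zero, sub_zero, neg_smul,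
    smul_assoc (n + 1), mul_smul, add_smul (2 • Z), smul_assoc, smul_assoc, one_smul] at commutator

theorem weight_smul_pow_smul (h : IsLadder Z R L) (n : ℕ) (v : M) :
    Z • R ^ n • v = R ^ n • Z • v + n • R ^ n • v := by
  have commutator := congr($(lie_pow_of_lie_eq_self h.lie_raise n) • v)
  rwa [Ring.lie_def, sub_smul, mul_smul, mul_smul, smul_assoc, sub_eq_iff_eq_add'] at commutator

theorem lower_smul_weight_smul (h : IsLadder Z R L) {v : M} (hv : L • v = 0) :
    L • Z • v = 0 := by
  have commutator := congr($(h.lie_lower) • v)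
  simpa [Ring.lie_def, sub_smul, mul_smul, hv] using commutator

/-- If `R ^ (n + 1)` kills a vector `v` annihilated by `L`, then `R ^ n` kills `(2 Z + n) v`, which
is again annihilated by `L`: either this vector vanishes, or it takes the place of `v`. -/
theorem exists_lowest_weight_smul [IsAddTorsionFree M] (h : IsLadder Z R L) (n : ℕ) {v : M}
    (hv : v ≠ 0) (hL : L • v = 0) (hR : R ^ n • v = 0) :
    ∃ (w : M) (k : ℕ), w ≠ 0 ∧ L • w = 0 ∧ 2 • Z • w = -(k • w) := by
  induction n generalizing v with
  | zero => exact absurd (by simpa using hR) hv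
  | succ n ih =>
    by_cases hu : 2 • Z • v + n • v = 0
    · exact ⟨v, n, hv, hL, eq_neg_of_add_eq_zero_left hu⟩
    · refine ih hu ?_ ?_
      · rw [smul_add, smul_comm L (2 : ℕ), smul_comm L n, h.lower_smul_weight_smul hL, hL,
          smul_zero, smul_zero, add_zero]
      · have := h.lower_smul_pow_succ_smul hL n
        rw [hR, smul_zero, zero_eq_neg] at this
        exact (nsmul_eq_zero_iff_right n.succ_ne_zero).1 this

end IsLadder

theorem exists_ne_zero_smul_eq_zero_of_isNilpotent [Nontrivial M] {a : A} (ha : IsNilpotent a) :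
    ∃ v : M, v ≠ 0 ∧ a • v = 0 := by
  by_contra! injective
  obtain ⟨v, hv⟩ := exists_ne (0 : M)
  have pow_smul_ne_zero (n : ℕ) : a ^ n • v ≠ 0 := by
    induction n with
    | zero => simpa using hv
    | succ n ih => rw [pow_succ', mul_smul]; exact injective _ ih
  obtain ⟨n, hn⟩ := ha
  exact pow_smul_ne_zero n (by rw [hn, zero_smul])

theorem finite_range_pow_smul_of_isNilpotent {a : A} (ha : IsNilpotent a) (v : M) :
    (Set.range fun k : ℕ => a ^ k • v).Finite := by
  obtain ⟨n, hn⟩ := ha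
  refine (((Set.finite_lt_nat n).image fun k => a ^ k • v).insert 0).subset ?_
  rintro _ ⟨k, rfl⟩
  rcases lt_or_ge k n with hk | hk
  · exact Or.inr ⟨k, hk, rfl⟩
  · exact Or.inl (by simp only [pow_eq_zero_of_le hk hn, zero_smul])

end Ladder

/-- The powers of `R` are eigenvectors of the bounded map `⁅Z, ·⁆` with eigenvalues `n c`. -/
theorem isNilpotent_of_lie_eq_smul {𝕜 A : Type*} [RCLike 𝕜] [NormedRing A] [NormedAlgebra 𝕜 A]
    {Z R : A} {c : 𝕜} (hc : c ≠ 0) (h : ⁅Z, R⁆ = c • R) : IsNilpotent R := by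
  set W := c⁻¹ • Z
  have lie_pow (n : ℕ) : ⁅W, R ^ n⁆ = n • R ^ n :=
    lie_pow_of_lie_eq_self (by rw [smul_lie, h, inv_smul_smul₀ hc]) n
  obtain ⟨n, hn⟩ := exists_nat_gt (2 * ‖W‖)
  refine ⟨n, norm_eq_zero.1 ?_⟩
  have bound : n * ‖R ^ n‖ ≤ 2 * ‖W‖ * ‖R ^ n‖ :=
    calc n * ‖R ^ n‖ = ‖⁅W, R ^ n⁆‖ := by rw [lie_pow, RCLike.norm_nsmul 𝕜, nsmul_eq_mul]
      _ ≤ ‖W * R ^ n‖ + ‖R ^ n * W‖ := norm_sub_le _ _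
      _ ≤ ‖W‖ * ‖R ^ n‖ + ‖R ^ n‖ * ‖W‖ := add_le_add (norm_mul_le _ _) (norm_mul_le _ _)
      _ = 2 * ‖W‖ * ‖R ^ n‖ := by ring
  nlinarith [norm_nonneg (R ^ n)]

section Irreducible

variable {𝕜 E : Type*} [NontriviallyNormedField 𝕜] [NormedAddCommGroup E] [NormedSpace 𝕜 E]

/-- Topological irreducibility of a set of bounded operators: the space is nonzero, and its only
closed subspaces invariant under every operator of the set are zero and the whole space. -/
structure IsTopologicallyIrreducible (B : Set (E →L[𝕜] E)) : Prop where
  nontrivial : Nontrivial E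
  eq_bot_or_eq_top : ∀ K : Submodule 𝕜 E, IsClosed (K : Set E) →
    (∀ T ∈ B, ∀ x ∈ K, T x ∈ K) → K = ⊥ ∨ K = ⊤

theorem IsTopologicallyIrreducible.of_subset_adjoin {B B' : Set (E →L[𝕜] E)}
    (h : IsTopologicallyIrreducible B) (hB : B ⊆ Algebra.adjoin 𝕜 B') :
    IsTopologicallyIrreducible B' where
  nontrivial := h.nontrivial
  eq_bot_or_eq_top K hK hinv := by
    refine h.eq_bot_or_eq_top K hK fun T hT => ?_
    refine Algebra.adjoin_induction (p := fun T _ => ∀ x ∈ K, T x ∈ K) hinv ?_ ?_ ?_ (hB hT)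
    · exact fun r x hx => K.smul_mem r hx
    · exact fun S T _ _ hS hT x hx => K.add_mem (hS x hx) (hT x hx)
    · exact fun S T _ _ hS hT x hx => hS _ (hT x hx)

end Irreducible

namespace IsLadder

variable {E : Type*} [NormedAddCommGroup E] [NormedSpace ℂ E] {Z R L : E →L[ℂ] E}

theorem isNilpotent_raise (h : IsLadder Z R L) : IsNilpotent R :=
  isNilpotent_of_lie_eq_smul (one_ne_zero (α := ℂ)) (by rw [h.lie_raise, one_smul])

theorem isNilpotent_lower (h : IsLadder Z R L) : IsNilpotent L :=
  isNilpotent_of_lie_eq_smul (neg_ne_zero.2 (one_ne_zero (α := ℂ)))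
    (by rw [h.lie_lower, neg_one_smul])

theorem exists_lowest_weight [Nontrivial E] (h : IsLadder Z R L) :
    ∃ (w : E) (μ : ℂ), w ≠ 0 ∧ L w = 0 ∧ Z w = μ • w := by
  obtain ⟨v, hv, hLv⟩ := exists_ne_zero_smul_eq_zero_of_isNilpotent (M := E) h.isNilpotent_lower
  obtain ⟨n, hn⟩ := h.isNilpotent_raise
  have := IsAddTorsionFree.of_isTorsionFree ℂ E
  obtain ⟨w, k, hw, hLw, hZw⟩ := h.exists_lowest_weight_smul n hv hLv (by rw [hn, zero_smul])
  refine ⟨w, -k / 2, hw, hLw, ?_⟩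
  rw [ContinuousLinearMap.smul_def] at hZw
  linear_combination (norm := module) (1 / 2 : ℂ) • hZw

theorem apply_pow_of_weight (h : IsLadder Z R L) {w : E} {μ : ℂ} (hZ : Z w = μ • w) (k : ℕ) :
    Z ((R ^ k) w) = (μ + k) • (R ^ k) w := by
  have := h.weight_smul_pow_smul k w
  simp only [ContinuousLinearMap.smul_def, hZ, map_smul] at this
  rw [this]
  module

theorem lower_apply_pow_succ_of_lowest_weight (h : IsLadder Z R L) {w : E} {μ : ℂ} (hL : L w = 0)
    (hZ : Z w = μ • w) (k : ℕ) :
    L ((R ^ (k + 1)) w) = (-(k + 1) * (2 * μ + k)) • (R ^ k) w := by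
  have := h.lower_smul_pow_succ_smul hL k
  simp only [ContinuousLinearMap.smul_def, hZ, map_add, map_smul, map_nsmul] at this
  rw [this]
  module

theorem iSup_span_pow_apply_eq_top (h : IsLadder Z R L)
    (hirr : IsTopologicallyIrreducible {Z, R, L}) {w : E} {μ : ℂ} (hw : w ≠ 0) (hL : L w = 0)
    (hZ : Z w = μ • w) : ⨆ k : ℕ, ℂ ∙ (R ^ k) w = ⊤ := by
  rw [← Submodule.span_range_eq_iSup]
  set K := Submodule.span ℂ (Set.range fun k : ℕ => (R ^ k) w)
  have pow_mem (k : ℕ) : (R ^ k) w ∈ K := Submodule.subset_span ⟨k, rfl⟩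
  have : FiniteDimensional ℂ K :=
    FiniteDimensional.span_of_finite ℂ (finite_range_pow_smul_of_isNilpotent h.isNilpotent_raise w)
  have mem_of_pow {T : E →L[ℂ] E} (hT : ∀ k, T ((R ^ k) w) ∈ K) : ∀ x ∈ K, T x ∈ K := by
    suffices K ≤ K.comap (T : E →ₗ[ℂ] E) from this
    rw [Submodule.span_le]
    rintro _ ⟨k, rfl⟩
    exact hT k
  refine (hirr.eq_bot_or_eq_top K K.closed_of_finiteDimensional ?_).resolve_left ?_
  · rintro T (rfl | rfl | rfl)
    · refine mem_of_pow fun k => ?_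
      rw [h.apply_pow_of_weight hZ]
      exact K.smul_mem _ (pow_mem k)
    · refine mem_of_pow fun k => ?_
      rw [← mul_apply_eq_comp, ← pow_succ']
      exact pow_mem (k + 1)
    · refine mem_of_pow fun k => ?_
      cases k with
      | zero => simp [hL]
      | succ k =>
        rw [h.lower_apply_pow_succ_of_lowest_weight hL hZ]
        exact K.smul_mem _ (pow_mem k)
  · exact fun hbot => hw (by simpa [hbot] using pow_mem 0)

/-- Let `w` be a lowest weight vector, of weight `μ`. The weight space of `μ + n` is spanned by
`(R ^ n) w` and contains `T w`; as `T` commutes with `R`, it is determined by `T w`. -/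
theorem exists_eq_smul_pow (h : IsLadder Z R L) (hirr : IsTopologicallyIrreducible {Z, R, L})
    {T : E →L[ℂ] E} {n : ℕ} (hR : Commute R T) (hZ : ⁅Z, T⁆ = n • T) : ∃ a : ℂ, T = a • R ^ n := by
  have := hirr.nontrivial
  obtain ⟨w, μ, hw, hLw, hZw⟩ := h.exists_lowest_weight
  have span_eq_top := h.iSup_span_pow_apply_eq_top hirr hw hLw hZw
  have weight_indep : iSupIndep fun k : ℕ => Module.End.eigenspace (Z : E →ₗ[ℂ] E) (μ + k) :=
    (Module.End.eigenspaces_iSupIndep _).comp fun k l hkl => by simpa using hkl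
  have span_eq_eigenspace := (weight_indep.le_iff_eq_of_iSup_eq_top span_eq_top).1 fun k =>
    (Submodule.span_singleton_le_iff_mem _ _).2
      (Module.End.mem_eigenspace_iff.2 (h.apply_pow_of_weight hZw k))
  have weight_apply : Z (T w) = (μ + n) • T w := by
    have := congr($hZ w)
    simp only [Ring.lie_def, sub_apply, mul_apply_eq_comp, smul_apply, hZw, map_smul] at this
    linear_combination (norm := module) this
  obtain ⟨a, ha⟩ : ∃ a : ℂ, a • (R ^ n) w = T w := by
    rw [← Submodule.mem_span_singleton, congr_fun span_eq_eigenspace n]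
    exact Module.End.mem_eigenspace_iff.2 weight_apply
  refine ⟨a, ContinuousLinearMap.coe_injective
    (LinearMap.ext_on_range (v := fun k : ℕ => (R ^ k) w) ?_ fun k => ?_)⟩
  · rw [Submodule.span_range_eq_iSup, span_eq_top]
  · calc T ((R ^ k) w) = (R ^ k) (T w) := congr($((hR.pow_left k).eq.symm) w)
      _ = a • (R ^ k) ((R ^ n) w) := by rw [← ha, map_smul]
      _ = a • (R ^ n) ((R ^ k) w) := congr(a • $((Commute.pow_pow_self R k n).eq) w)

end IsLadder

section Spin

/-- The vector `x + i y`, along which a spin raises weights; it is isotropic for `⬝ᵥ`. -/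
def raisingVec : Fin 3 → ℂ := ![1, I, 0]

/-- The vector `x - i y`, along which a spin lowers weights. -/
def loweringVec : Fin 3 → ℂ := ![1, -I, 0]

/-- The third coordinate vector, along which a spin measures weights. -/
def axisVec : Fin 3 → ℂ := ![0, 0, 1]

theorem axisVec_cross_raisingVec : axisVec ⨯₃ raisingVec = -I • raisingVec := by
  ext i; fin_cases i <;> simp [cross_apply, axisVec, raisingVec]

theorem axisVec_cross_loweringVec : axisVec ⨯₃ loweringVec = I • loweringVec := by
  ext i; fin_cases i <;> simp [cross_apply, axisVec, loweringVec]

theorem raisingVec_cross_loweringVec : raisingVec ⨯₃ loweringVec = -(2 * I) • axisVec := by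
  ext i; fin_cases i <;> simp [cross_apply, axisVec, raisingVec, loweringVec]
  ring

theorem eq_axisVec_add_raisingVec_add_loweringVec (u : Fin 3 → ℂ) :
    u = u 2 • axisVec + ((u 0 - I * u 1) / 2) • raisingVec
      + ((u 0 + I * u 1) / 2) • loweringVec := by
  ext i
  fin_cases i <;> simp [axisVec, raisingVec, loweringVec] <;> ring_nf
  simp

variable {A : Type*} [Ring A] [Algebra ℂ A] {J : (Fin 3 → ℂ) →ₗ[ℂ] A}
  {X : (Fin 3 → ℂ) →ₗ[ℂ] (Fin 3 → ℂ) →ₗ[ℂ] A}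

/-- The commutation relations `[J_x, J_y] = i J_z` (and cyclic) of a spin `J`, extended linearly to
complex vectors. -/
def IsSpin (J : (Fin 3 → ℂ) →ₗ[ℂ] A) : Prop :=
  ∀ u v, ⁅J u, J v⁆ = I • J (u ⨯₃ v)

/-- The symmetric tensor operators of rank two for a spin `J`: symmetric bilinear forms in the
vector arguments whose values transform under commutation with `J` as their arguments do. -/
def symmTensors (J : (Fin 3 → ℂ) →ₗ[ℂ] A) :
    Submodule ℂ ((Fin 3 → ℂ) →ₗ[ℂ] (Fin 3 → ℂ) →ₗ[ℂ] A) where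
  carrier := {X | (∀ v w, X v w = X w v) ∧
    ∀ u v w, ⁅J u, X v w⁆ = I • (X (u ⨯₃ v) w + X v (u ⨯₃ w))}
  zero_mem' := by simp
  add_mem' := by
    rintro X Y ⟨hX, hX'⟩ ⟨hY, hY'⟩
    refine ⟨fun v w => ?_, fun u v w => ?_⟩
    · simp only [LinearMap.add_apply, hX v, hY v]
    · simp only [LinearMap.add_apply, lie_add, hX', hY']
      module
  smul_mem' := by
    rintro c X ⟨hX, hX'⟩
    refine ⟨fun v w => ?_, fun u v w => ?_⟩
    · simp only [LinearMap.smul_apply, hX v]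
    · simp only [LinearMap.smul_apply, lie_smul, hX']
      module

/-- The symmetrized product `J u * J v + J v * J u` of two components of a spin. -/
def symmProd (J : (Fin 3 → ℂ) →ₗ[ℂ] A) : (Fin 3 → ℂ) →ₗ[ℂ] (Fin 3 → ℂ) →ₗ[ℂ] A :=
  (LinearMap.mul ℂ A).compl₁₂ J J + ((LinearMap.mul ℂ A).compl₁₂ J J).flip

theorem symmProd_apply (u v : Fin 3 → ℂ) : symmProd J u v = J u * J v + J v * J u :=
  rfl

theorem IsSpin.symmProd_mem_symmTensors (hJ : IsSpin J) : symmProd J ∈ symmTensors J := by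
  refine ⟨fun v w => add_comm _ _, fun u v w => ?_⟩
  simp only [symmProd_apply, lie_add, lie_mul, hJ u, smul_mul_assoc, mul_smul_comm]
  module

theorem IsSpin.isLadder (hJ : IsSpin J) :
    IsLadder (J axisVec) (J raisingVec) (J loweringVec) where
  lie_raise := by
    rw [hJ, axisVec_cross_raisingVec, map_smul, smul_smul, mul_neg, I_mul_I, neg_neg, one_smul]
  lie_lower := by
    rw [hJ, axisVec_cross_loweringVec, map_smul, smul_smul, I_mul_I, neg_one_smul]
  lie_raise_lower := by
    rw [hJ, raisingVec_cross_loweringVec, map_smul, smul_smul, mul_neg, mul_left_comm, I_mul_I,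
      mul_neg_one, neg_neg, ofNat_smul_eq_nsmul]

namespace symmTensors

theorem lie_axisVec_highest (hX : X ∈ symmTensors J) :
    ⁅J axisVec, X raisingVec raisingVec⁆ = 2 • X raisingVec raisingVec := by
  rw [hX.2, axisVec_cross_raisingVec, map_smul, map_smul, LinearMap.smul_apply]
  linear_combination (norm := module) (-2 * I_mul_I) • X raisingVec raisingVec

theorem commute_raisingVec_highest (hX : X ∈ symmTensors J) :
    Commute (J raisingVec) (X raisingVec raisingVec) := by
  rw [commute_iff_lie_eq, hX.2, cross_self, map_zero, map_zero, LinearMap.zero_apply, add_zero,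
    smul_zero]

theorem apply_cross_add_apply_cross_eq_zero (hX : X ∈ symmTensors J) (u : Fin 3 → ℂ)
    {v w : Fin 3 → ℂ} (hvw : X v w = 0) : X (u ⨯₃ v) w + X v (u ⨯₃ w) = 0 := by
  rw [← smul_eq_zero_iff_right I_ne_zero, ← hX.2, hvw, lie_zero]

/-- Commutation with `J loweringVec` carries the vanishing highest component
`X raisingVec raisingVec` successively into multiples of the lower ones. -/
theorem apply_eq_dotProduct_smul (hX : X ∈ symmTensors J)
    (highest : X raisingVec raisingVec = 0) (u v : Fin 3 → ℂ) :
    X u v = (u ⬝ᵥ v) • X axisVec axisVec := by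
  have cross_raising : loweringVec ⨯₃ raisingVec = (2 * I) • axisVec := by
    rw [← cross_anticomm, raisingVec_cross_loweringVec, neg_smul, neg_neg]
  have cross_axis : loweringVec ⨯₃ axisVec = -I • loweringVec := by
    rw [← cross_anticomm, axisVec_cross_loweringVec, neg_smul]
  have raising_axis : X raisingVec axisVec = 0 := by
    have := apply_cross_add_apply_cross_eq_zero hX loweringVec highest
    rw [cross_raising, map_smul, map_smul, LinearMap.smul_apply, hX.1 axisVec, ← two_smul ℂ,
      smul_smul] at this
    exact (smul_eq_zero_iff_right (by simp)).1 this
  have raising_lowering : X raisingVec loweringVec = (2 : ℂ) • X axisVec axisVec := by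
    have := apply_cross_add_apply_cross_eq_zero hX loweringVec raising_axis
    rw [cross_raising, cross_axis, map_smul, map_smul, LinearMap.smul_apply] at this
    linear_combination (norm := module)
      I • this - I_mul_I • ((2 : ℂ) • X axisVec axisVec - X raisingVec loweringVec)
  have axis_lowering : X axisVec loweringVec = 0 := by
    have := congr(⁅J loweringVec, $raising_lowering⁆)
    simp only [lie_smul, hX.2, cross_raising, cross_axis, cross_self, map_smul, map_zero,
      LinearMap.smul_apply, hX.1 loweringVec axisVec] at this
    linear_combination (norm := module)
      (-1 / 6 : ℂ) • this + I_mul_I • X axisVec loweringVec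
  have lowering_lowering : X loweringVec loweringVec = 0 := by
    have := apply_cross_add_apply_cross_eq_zero hX loweringVec axis_lowering
    rw [cross_axis, cross_self, map_zero, add_zero, map_smul, LinearMap.smul_apply] at this
    exact (smul_eq_zero_iff_right (by simp)).1 this
  conv_lhs => rw [eq_axisVec_add_raisingVec_add_loweringVec u,
    eq_axisVec_add_raisingVec_add_loweringVec v]
  simp only [map_add, map_smul, LinearMap.add_apply, LinearMap.smul_apply, highest,
    hX.1 axisVec raisingVec, hX.1 loweringVec, raising_axis, raising_lowering, axis_lowering,
    lowering_lowering, Matrix.vec3_dotProduct]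
  linear_combination (norm := module) (-(u 1 * v 1) * I_mul_I) • X axisVec axisVec

theorem commute_apply_axisVec_axisVec (hX : X ∈ symmTensors J)
    (isotropic : ∀ u v, X u v = (u ⬝ᵥ v) • X axisVec axisVec) (u : Fin 3 → ℂ) :
    Commute (J u) (X axisVec axisVec) := by
  rw [commute_iff_lie_eq, hX.2, isotropic (u ⨯₃ axisVec), isotropic axisVec (u ⨯₃ axisVec),
    dotProduct_comm (u ⨯₃ axisVec), dot_cross_self, zero_smul, add_zero, smul_zero]

end symmTensors

end Spin

section SpinOperators

variable {E : Type*} [NormedAddCommGroup E] [NormedSpace ℂ E]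
  {J : (Fin 3 → ℂ) →ₗ[ℂ] E →L[ℂ] E} {X : (Fin 3 → ℂ) →ₗ[ℂ] (Fin 3 → ℂ) →ₗ[ℂ] E →L[ℂ] E}

theorem IsTopologicallyIrreducible.spin_ladder (h : IsTopologicallyIrreducible (Set.range J)) :
    IsTopologicallyIrreducible {J axisVec, J raisingVec, J loweringVec} := by
  refine h.of_subset_adjoin ?_
  rintro _ ⟨u, rfl⟩
  have mem {T : E →L[ℂ] E} (hT : T ∈ ({J axisVec, J raisingVec, J loweringVec} : Set _)) (c : ℂ) :
      c • T ∈ Algebra.adjoin ℂ {J axisVec, J raisingVec, J loweringVec} :=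
    Subalgebra.smul_mem _ (Algebra.subset_adjoin hT) c
  rw [eq_axisVec_add_raisingVec_add_loweringVec u]
  simp only [map_add, map_smul]
  exact add_mem (add_mem (mem (by simp) _) (mem (by simp) _)) (mem (by simp) _)

theorem IsSpin.exists_eq_smul_symmProd_add_smul_one (hJ : IsSpin J)
    (hirr : IsTopologicallyIrreducible (Set.range J)) (hX : X ∈ symmTensors J) :
    ∃ a c : ℂ, ∀ u v, X u v = a • symmProd J u v + (c * (u ⬝ᵥ v)) • 1 := by
  obtain ⟨a, ha⟩ := hJ.isLadder.exists_eq_smul_pow hirr.spin_ladder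
    (symmTensors.commute_raisingVec_highest hX) (symmTensors.lie_axisVec_highest hX)
  set Y := X - (a / 2) • symmProd J
  have hY : Y ∈ symmTensors J :=
    sub_mem hX (Submodule.smul_mem _ _ hJ.symmProd_mem_symmTensors)
  have highest : Y raisingVec raisingVec = 0 := by
    simp only [Y, LinearMap.sub_apply, LinearMap.smul_apply, symmProd_apply, ha, sq]
    module
  have isotropic := symmTensors.apply_eq_dotProduct_smul hY highest
  have commutes := symmTensors.commute_apply_axisVec_axisVec hY isotropic
  obtain ⟨c, hc⟩ := hJ.isLadder.exists_eq_smul_pow (n := 0) hirr.spin_ladder (commutes _)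
    (by rw [commute_iff_lie_eq.1 (commutes _), zero_smul])
  refine ⟨a / 2, c, fun u v => ?_⟩
  rw [mul_comm, mul_smul, ← pow_zero (J raisingVec), ← hc, ← isotropic]
  simp only [Y, LinearMap.sub_apply, LinearMap.smul_apply, add_sub_cancel]

end SpinOperators

section PoissonAlgebra

variable {s : ℝ}

theorem preBracket_mul_right (f g h : MvPolynomial (Fin 3) ℝ) :
    preBracket f (g * h) = preBracket f g * h + g * preBracket f h := by
  simp only [preBracket_eq, pderiv_mul]
  ring

theorem poisson_mul_right (p q r : Poly s) :
    poisson p (q * r) = poisson p q * r + q * poisson p r := by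
  obtain ⟨f, rfl⟩ := Ideal.Quotient.mk_surjective p
  obtain ⟨g, rfl⟩ := Ideal.Quotient.mk_surjective q
  obtain ⟨h, rfl⟩ := Ideal.Quotient.mk_surjective r
  simp only [← map_mul, ← map_add, poisson_mk, preBracket_mul_right]

theorem poisson_S_S (k i : Fin 3) : poisson (S k : Poly s) (S i) = ∑ m, eps k i m • S m := by
  have bracket : preBracket (X k) (X i) = ∑ m, eps k i m • (X m : MvPolynomial (Fin 3) ℝ) := by
    rw [preBracket_eq]
    fin_cases k <;> fin_cases i <;> simp [eps, pderiv_X]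
  simp only [S]
  rw [poisson_mk, bracket, map_sum]
  rfl

theorem sum_smul_poisson_S_S {M : Type*} [AddCommGroup M] [Module ℝ M] [Module ℂ M]
    (F : Poly s →ₗ[ℝ] M) (u v : Fin 3 → ℂ) :
    ∑ k, ∑ i, (u k * v i) • F (poisson (S k) (S i)) = ∑ m, (u ⨯₃ v) m • F (S m) := by
  simp only [poisson_S_S, eps, Fin.isValue, Fin.sum_univ_three, right_eq_add, Fin.reduceEq,
    Fin.reduceAdd, zero_ne_one, one_ne_zero, zero_add, and_self, and_true, and_false, ↓reduceIte,
    ite_smul, one_smul, neg_smul, zero_smul, smul_zero, smul_neg, add_zero, map_add, map_neg,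
    map_zero, cross_apply, Matrix.cons_val_zero, Matrix.cons_val_one, Matrix.cons_val]
  module

theorem sum_S_mul_S (s : ℝ) : ∑ i, (S i : Poly s) * S i = (s ^ 2) • (1 : Poly s) := by
  have relation : Ideal.Quotient.mk (sphereIdeal s) (∑ i, X i ^ 2) =
      Ideal.Quotient.mk (sphereIdeal s) (C (s ^ 2)) :=
    Ideal.Quotient.eq.2 (Ideal.mem_span_singleton_self _)
  rw [map_sum] at relation
  simp only [S, ← sq, ← map_pow]
  rw [relation, ← Algebra.algebraMap_eq_smul_one]
  rfl

theorem degLE_one_le_span (s : ℝ) :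
    degLE s 1 ≤ Submodule.span ℝ (insert 1 (Set.range (S : Fin 3 → Poly s))) := by
  rw [degLE, Submodule.map_le_iff_le_comap]
  intro p hp
  rw [mem_restrictTotalDegree] at hp
  rw [Submodule.mem_comap, p.as_sum, map_sum]
  refine Submodule.sum_mem _ fun d hd => ?_
  have degree_le : d.degree ≤ 1 := (le_totalDegree hd).trans hp
  rw [← mul_one (coeff d p), ← smul_eq_mul, ← smul_monomial, map_smul]
  refine Submodule.smul_mem _ _ (Submodule.subset_span ?_)
  rcases Nat.le_one_iff_eq_zero_or_eq_one.1 degree_le with h0 | h1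
  · obtain rfl := (Finsupp.degree_eq_zero_iff d).1 h0
    exact Or.inl (map_one (Ideal.Quotient.mk (sphereIdeal s)))
  · obtain ⟨i, rfl⟩ := (Finsupp.range_single_one).ge h1
    exact Or.inr ⟨i, rfl⟩

end PoissonAlgebra

open scoped ComplexStarModule in
theorem eq_re_smul_add_re_smul_of_isSelfAdjoint {A : Type*} [AddCommGroup A] [Module ℂ A]
    [StarAddMonoid A] [StarModule ℂ A] {x y z : A} (hx : IsSelfAdjoint x) (hy : IsSelfAdjoint y)
    (hz : IsSelfAdjoint z) {a b : ℂ} (h : x = a • y + b • z) : x = a.re • y + b.re • z := by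
  have realPart_eq := congr(((ℜ $h : selfAdjoint A) : A))
  simpa [realPart_smul, hx.coe_realPart, hy.coe_realPart, hz.coe_realPart, hy.imaginaryPart,
    hz.imaginaryPart] using realPart_eq

section Quantization

variable {s : ℝ} {A : Type*} [Ring A] [Algebra ℂ A]

/-- The operator `∑ u_i Q(S_i)`, the component of the quantized spin along a complex vector. -/
noncomputable def spinOperator (Q : Poly s →ₗ[ℝ] A) : (Fin 3 → ℂ) →ₗ[ℂ] A :=
  Fintype.linearCombination ℂ fun i => Q (S i)

/-- The operator `∑ v_i w_l Q(S_i S_l)`: the quantized quadratic polynomials, assembled into a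
bilinear form in two complex vectors. -/
noncomputable def quadraticOperator (Q : Poly s →ₗ[ℝ] A) : (Fin 3 → ℂ) →ₗ[ℂ] (Fin 3 → ℂ) →ₗ[ℂ] A :=
  Fintype.linearCombination ℂ fun i => Fintype.linearCombination ℂ fun l => Q (S i * S l)

variable (Q : Poly s →ₗ[ℝ] A)

theorem spinOperator_apply (u : Fin 3 → ℂ) : spinOperator Q u = ∑ i, u i • Q (S i) :=
  rfl

theorem quadraticOperator_apply (v w : Fin 3 → ℂ) :
    quadraticOperator Q v w = ∑ i, v i • ∑ l, w l • Q (S i * S l) := by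
  simp [quadraticOperator, Fintype.linearCombination_apply]

theorem spinOperator_single (i : Fin 3) : spinOperator Q (Pi.single i 1) = Q (S i) := by
  simp [spinOperator]

theorem quadraticOperator_single_single (i l : Fin 3) :
    quadraticOperator Q (Pi.single i 1) (Pi.single l 1) = Q (S i * S l) := by
  simp [quadraticOperator]

theorem quadraticOperator_comm (v w : Fin 3 → ℂ) :
    quadraticOperator Q v w = quadraticOperator Q w v := by
  simp only [quadraticOperator_apply, Finset.smul_sum]
  rw [Finset.sum_comm]
  simp only [smul_comm (w _), mul_comm (S _) (S _)]

theorem quadraticOperator_cross (u v w : Fin 3 → ℂ) :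
    quadraticOperator Q v (u ⨯₃ w) =
      ∑ k, u k • ∑ i, v i • ∑ l, w l • Q (S i * poisson (S k) (S l)) := by
  have inner (i : Fin 3) := sum_smul_poisson_S_S (Q ∘ₗ LinearMap.mulLeft ℝ (S i)) u w
  simp only [LinearMap.comp_apply, LinearMap.mulLeft_apply] at inner
  simp only [quadraticOperator_apply, ← inner, Finset.smul_sum, mul_smul]
  rw [Finset.sum_comm]
  simp only [smul_comm (u _)]

/-- The quantum commutation condition `[Q(f), Q(g)] = i Q({f, g})`, for a linear map into an
arbitrary complex algebra. -/
def IsPoissonMap (Q : Poly s →ₗ[ℝ] A) : Prop :=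
  ∀ f g, ⁅Q f, Q g⁆ = I • Q (poisson f g)

namespace IsPoissonMap

variable {Q}

theorem isSpin_spinOperator (h : IsPoissonMap Q) : IsSpin (spinOperator Q) := by
  intro u v
  rw [spinOperator_apply Q (u ⨯₃ v), ← sum_smul_poisson_S_S Q u v]
  simp only [spinOperator_apply, sum_lie, lie_sum, smul_lie, lie_smul, h _ _, Finset.smul_sum,
    mul_smul, smul_comm I]
  rw [Finset.sum_comm]
  simp only [smul_comm (v _) (u _)]

theorem quadraticOperator_mem_symmTensors (h : IsPoissonMap Q) :
    quadraticOperator Q ∈ symmTensors (spinOperator Q) := by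
  refine ⟨quadraticOperator_comm Q, fun u v w => ?_⟩
  rw [quadraticOperator_comm Q (u ⨯₃ v), quadraticOperator_cross, quadraticOperator_cross]
  simp only [spinOperator_apply, quadraticOperator_apply, sum_lie, lie_sum,
    smul_lie, lie_smul, h _ _, poisson_mul_right, map_add, smul_add, Finset.sum_add_distrib,
    Finset.smul_sum, smul_comm I]
  congr 1
  · rw [Finset.sum_comm_cycle]
    refine Finset.sum_congr rfl fun k _ => ?_
    rw [Finset.sum_comm]
    simp only [smul_comm (v _) (w _), smul_comm (v _) (u _), smul_comm (w _) (u _), mul_comm (S _)]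
  · rw [Finset.sum_comm_cycle]
    simp only [smul_comm (v _) (u _), smul_comm (w _) (u _)]

end IsPoissonMap

end Quantization

section AdmissibleQuantization

variable {s : ℝ} {H : Type*} [NormedAddCommGroup H] [InnerProductSpace ℂ H] [CompleteSpace H]
  {Q : Poly s →ₗ[ℝ] (H →L[ℂ] H)}

theorem IsQuantization.isPoissonMap (h : IsQuantization Q) : IsPoissonMap Q := by
  intro f g
  rw [h.map_poisson, smul_smul, mul_neg, I_mul_I, neg_neg, one_smul, Ring.lie_def]

namespace IsAdmissibleQuantization

theorem isTopologicallyIrreducible_spinOperator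
    (h : IsAdmissibleQuantization Q (degLE s 1)) :
    IsTopologicallyIrreducible (Set.range (spinOperator Q)) := by
  have irreducible : IsTopologicallyIrreducible (Q '' degLE s 1) :=
    ⟨h.nontrivial, fun K hK hinv =>
      h.eq_bot_or_eq_top K hK fun f hf => hinv _ (Set.mem_image_of_mem Q hf)⟩
  refine irreducible.of_subset_adjoin (Set.image_subset_iff.2 ?_)
  set B := Algebra.adjoin ℂ (Set.range (spinOperator Q))
  suffices degLE s 1 ≤ (B.toSubmodule.restrictScalars ℝ).comap Q from this
  refine (degLE_one_le_span s).trans (Submodule.span_le.2 ?_)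
  rintro _ (rfl | ⟨i, rfl⟩)
  · simp [h.map_one]
  · exact Algebra.subset_adjoin ⟨Pi.single i 1, spinOperator_single Q i⟩

theorem exists_map_S_mul_S_eq (h : IsAdmissibleQuantization Q (degLE s 1)) :
    ∃ a c : ℝ, ∀ i l, Q (S i * S l) =
      a • (Q (S i) * Q (S l) + Q (S l) * Q (S i)) + (if i = l then c else 0) • 1 := by
  have hQ := h.isPoissonMap
  obtain ⟨a, c, hac⟩ := hQ.isSpin_spinOperator.exists_eq_smul_symmProd_add_smul_one
    h.isTopologicallyIrreducible_spinOperator hQ.quadraticOperator_mem_symmTensors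
  refine ⟨a.re, c.re, fun i l => ?_⟩
  have complex_identity := hac (Pi.single i 1) (Pi.single l 1)
  rw [quadraticOperator_single_single, symmProd_apply, spinOperator_single,
    spinOperator_single] at complex_identity
  have symmetrized : IsSelfAdjoint (Q (S i) * Q (S l) + Q (S l) * Q (S i)) := by
    rw [isSelfAdjoint_iff, star_add, star_mul, star_mul, (h.isSelfAdjoint _).star_eq,
      (h.isSelfAdjoint _).star_eq, add_comm]
  rw [eq_re_smul_add_re_smul_of_isSelfAdjoint (h.isSelfAdjoint _) symmetrized (.one _)
    complex_identity]
  by_cases hil : i = l <;> simp [hil]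

end IsAdmissibleQuantization

end AdmissibleQuantization

end SpinSphere

theorem proposition2 (s : ℝ) (hs : 0 < s)
    {H : Type*} [NormedAddCommGroup H] [InnerProductSpace ℂ H] [CompleteSpace H]
    (Q : SpinSphere.Poly s →ₗ[ℝ] (H →L[ℂ] H))
    (hQ : SpinSphere.IsAdmissibleQuantization Q (SpinSphere.degLE s 1)) :
    ∃ a c : ℝ, a ^ 2 + c ^ 2 ≠ 0 ∧
      (∀ i : Fin 3,
        Q (SpinSphere.S i ^ 2) = a • Q (SpinSphere.S i) ^ 2 + c • (1 : H →L[ℂ] H)) ∧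
      (∀ i l : Fin 3, i ≠ l →
        Q (SpinSphere.S i * SpinSphere.S l) =
          (a / 2) • (Q (SpinSphere.S i) * Q (SpinSphere.S l)
            + Q (SpinSphere.S l) * Q (SpinSphere.S i))) := by
  obtain ⟨a, c, hac⟩ := hQ.exists_map_S_mul_S_eq
  have := hQ.nontrivial
  refine ⟨2 * a, c, fun hzero => ?_, fun i => ?_, fun i l hil => ?_⟩
  · obtain ⟨rfl, rfl⟩ : a = 0 ∧ c = 0 := by constructor <;> nlinarith
    have trace := congr(Q $(SpinSphere.sum_S_mul_S s))
    have : s ^ 2 • (1 : H →L[ℂ] H) = 0 := by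
      simpa [hac, hQ.map_one] using trace.symm
    exact (smul_ne_zero (pow_ne_zero 2 hs.ne') one_ne_zero) this
  · rw [sq, hac, if_pos rfl, sq, ← two_smul ℝ, smul_smul, mul_comm a]
  · rw [hac, if_neg hil, zero_smul, add_zero, mul_div_cancel_left₀ a two_ne_zero]
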